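/- Let $m$ be a positive integer. Let $I_k=\{1,\dots,m\}^k$ be the set of words of length $k$ ($I_0=\{\emptyset\}$), $I=\bigcup_{k\ge 0} I_k$, and $I_\infty=\{1,\dots,m\}^{\mathbb N}$; for $\mathbf i\in I$ write $|\mathbf i|$ for its length and let $C_{\mathbf i}\subseteq I_\infty$ be the cylinder of all infinite words that have $\mathbf i$ as an initial segment. Let $\{W_{\mathbf i}:\mathbf i\in I\}$ be independent, (almost surely) strictly positive random variables on a probability space, not necessarily identically distributed, with $\mathbb E(W_{\mathbf i})=1$ for each $\mathbf i\in I$, and set $$X_{i_1,\dots,i_k}=W_{i_1}W_{i_1,i_2}\cdots W_{i_1,\dots,i_k},\qquad X_\emptyset=1.$$ Let $\mu$ be a Borel probability measure on $I_\infty$ and put $Y_{\mathbf i}=X_{\mathbf i}\,\mu(C_{\mathbf i})$ for $\mathbf i\in I$. Let $q\ge 1$ be real, and suppose that $$\limsup_{k\to\infty}\Big(\sum_{|\mathbf i|=k}\mathbb E\big(Y_{\mathbf i}^q\big)\Big)^{1/k}<1 ,$$ where expectations of nonnegative random variables take values in $[0,\infty]$. Then $$\limsup_{k\to\infty}\mathbb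 E\Big(\Big(\sum_{|\mathbf i|=k}Y_{\mathbf i}\Big)^q\Big)<\infty ,\qquad\text{and moreover}\qquad \sup_{k\ge 0}\mathbb E\Big(\Big(\sum_{|\mathbf i|=k}Y_{\mathbf i}\Big)^q\Big)<\infty .$$ -/

import Mathlib

open MeasureTheory ProbabilityTheory Filter

namespace Cascade

/-- The cylinder of the finite word `i` over the alphabet `Fin m`: all infinite words of which `i`
is a curtailment (an initial segment). Infinite words are functions `ℕ → Fin m`; the product
σ-algebra on them is the Borel σ-algebra. -/
def cylinder {m : ℕ} (i : List (Fin m)) : Set (ℕ → Fin m) :=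
  {x | ∀ (r : ℕ) (hr : r < i.length), x r = i[r]}

/-- The multiplicative cascade
`X_{i₁,…,iₖ} = W_{i₁} W_{i₁,i₂} ⋯ W_{i₁,…,iₖ}` (so `X_∅ = 1`). -/
def X {m : ℕ} {Ω : Type*} (W : List (Fin m) → Ω → ℝ) (i : List (Fin m)) (ω : Ω) : ℝ :=
  ∏ r ∈ Finset.range i.length, W (i.take (r + 1)) ω

/-- `Y_i = X_i μ(C_i)`. -/
noncomputable def Y {m : ℕ} {Ω : Type*} (W : List (Fin m) → Ω → ℝ) (μ : Measure (ℕ → Fin m))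
    (i : List (Fin m)) (ω : Ω) : ℝ :=
  X W i ω * μ.real (cylinder i)

end Cascade

/-! With `q = 1 + p`, write `S ^ q = ∑ₐ Zₐ S ^ p` for a sum `S` of independent nonnegative `Zₐ`.
Since `(x + y) ^ p ≤ s x ^ p + C y ^ p` with `s` arbitrarily close to `1`, splitting `S` into `Zₐ`
and the rest, which is independent of `Zₐ`, gives a Rosenthal inequality
`E S ^ q ≤ s ∑ₐ E Zₐ ^ q + K (∑ₐ E Zₐ) ^ q`. Applied to the subtrees of the children of the root,
it bounds the `q`-th moment of generation `n` by a constant times `∑ⱼ s ^ j Mⱼ`, where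
`Mⱼ = ∑_{|i| = j} E Yᵢ ^ q`. The leading constant is compounded over the generations, so it must be
close to `1`: the hypothesis says that `Mⱼ` decays geometrically, hence the series converges for `s`
close to `1`. -/

namespace Cascade

open scoped ENNReal NNReal

section Inequalities

theorem le_mul_or_le_inv_mul {d : ℝ≥0} (hd : d ≠ 0) (x y : ℝ≥0∞) :
    y ≤ d * x ∨ x ≤ (d⁻¹ : ℝ≥0) * y := by
  rw [ENNReal.coe_inv hd,
    ← ENNReal.mul_le_iff_le_inv (ENNReal.coe_ne_zero.2 hd) ENNReal.coe_ne_top]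
  exact le_total _ _

theorem exists_add_rpow_le {p : ℝ} (hp : 0 ≤ p) {s : ℝ≥0} (hs : 1 < s) :
    ∃ C : ℝ≥0, ∀ x y : ℝ≥0∞, (x + y) ^ p ≤ s * x ^ p + C * y ^ p := by
  obtain ⟨t, ht, hts⟩ : ∃ t : ℝ≥0, 1 < t ∧ t ^ p ≤ s := by
    refine ⟨s ^ (p + 1)⁻¹, NNReal.one_lt_rpow hs (by positivity), ?_⟩
    have hexp : (p + 1)⁻¹ * p ≤ 1 := by rw [inv_mul_le_one₀ (by positivity)]; linarith
    simpa only [← NNReal.rpow_mul, NNReal.rpow_one] using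
      NNReal.rpow_le_rpow_of_exponent_le hs.le hexp
  obtain ⟨d, hd0, hdt⟩ : ∃ d : ℝ≥0, d ≠ 0 ∧ 1 + d = t :=
    ⟨t - 1, (tsub_pos_of_lt ht).ne', add_tsub_cancel_of_le ht.le⟩
  refine ⟨(d⁻¹ + 1) ^ p, fun x y => ?_⟩
  rcases le_mul_or_le_inv_mul hd0 x y with hy | hx
  · calc (x + y) ^ p ≤ (x + d * x) ^ p := by gcongr
      _ = (t ^ p : ℝ≥0) * x ^ p := by
        rw [← hdt, ENNReal.coe_rpow_of_nonneg _ hp, ← ENNReal.mul_rpow_of_nonneg _ _ hp]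
        push_cast
        rw [add_mul, one_mul]
      _ ≤ s * x ^ p := by gcongr
      _ ≤ _ := le_self_add
  · calc (x + y) ^ p ≤ ((d⁻¹ : ℝ≥0) * y + y) ^ p := by gcongr
      _ = ((d⁻¹ + 1) ^ p : ℝ≥0) * y ^ p := by
        rw [ENNReal.coe_rpow_of_nonneg _ hp, ← ENNReal.mul_rpow_of_nonneg _ _ hp]
        push_cast
        rw [add_mul, one_mul]
      _ ≤ _ := le_add_self

theorem mul_rpow_le_add {p : ℝ} (hp : 0 ≤ p) {d : ℝ≥0} (hd : d ≠ 0) (c x : ℝ≥0∞) :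
    c * x ^ p ≤ d * x ^ (1 + p) + (d⁻¹ ^ p : ℝ≥0) * c ^ (1 + p) := by
  simp only [ENNReal.rpow_add_of_nonneg _ _ zero_le_one hp, ENNReal.rpow_one]
  rcases le_mul_or_le_inv_mul hd x c with hc | hx
  · calc c * x ^ p ≤ d * x * x ^ p := by gcongr
      _ = d * (x * x ^ p) := mul_assoc _ _ _
      _ ≤ _ := le_self_add
  · calc c * x ^ p ≤ c * ((d⁻¹ : ℝ≥0) * c) ^ p := by gcongr
      _ = (d⁻¹ ^ p : ℝ≥0) * (c * c ^ p) := by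
        rw [ENNReal.mul_rpow_of_nonneg _ _ hp, ENNReal.coe_rpow_of_nonneg _ hp, mul_left_comm]
      _ ≤ _ := le_add_self

theorem mul_le_of_le_add_mul {a b x y : ℝ≥0∞} (hab : a + b = 1) (hx : x ≠ ∞)
    (h : x ≤ y + b * x) : a * x ≤ y := by
  have hb : b ≠ ∞ := ne_top_of_le_ne_top ENNReal.one_ne_top (hab ▸ le_add_self)
  rwa [← ENNReal.add_le_add_iff_right (ENNReal.mul_ne_top hb hx), ← add_mul, hab, one_mul]

theorem sum_rpow_le_card_rpow_mul {ι : Type*} [Fintype ι] (z : ι → ℝ≥0∞) {q : ℝ} (hq : 1 ≤ q) :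
    (∑ a, z a) ^ q ≤ (Fintype.card ι : ℝ≥0∞) ^ (q - 1) * ∑ a, z a ^ q := by
  simpa only [Finset.card_univ] using
    ENNReal.rpow_sum_le_const_mul_sum_rpow Finset.univ z hq

end Inequalities

section Rosenthal

variable {ι Ω : Type*} [Fintype ι] [MeasurableSpace Ω] {P : Measure Ω} {Z : ι → Ω → ℝ≥0∞}

theorem lintegral_mul_sum_rpow_le (hZ : ∀ a, Measurable (Z a)) (hind : iIndepFun Z P)
    {p : ℝ} (hp : 0 ≤ p) {s C : ℝ≥0∞}
    (hsC : ∀ x y : ℝ≥0∞, (x + y) ^ p ≤ s * x ^ p + C * y ^ p) (a : ι) :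
    ∫⁻ ω, Z a ω * (∑ b, Z b ω) ^ p ∂P ≤
      s * ∫⁻ ω, Z a ω ^ (1 + p) ∂P + C * ((∫⁻ ω, Z a ω ∂P) * ∫⁻ ω, (∑ b, Z b ω) ^ p ∂P) := by
  classical
  set T : Ω → ℝ≥0∞ := fun ω => ∑ b ∈ Finset.univ.erase a, Z b ω
  have hT_meas : Measurable T := Finset.measurable_fun_sum _ fun b _ => hZ b
  have hsplit (ω : Ω) : ∑ b, Z b ω = Z a ω + T ω :=
    (Finset.add_sum_erase _ (Z · ω) (Finset.mem_univ a)).symm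
  have hZT : IndepFun (Z a) T P := by
    simpa only [Finset.sum_fn] using
      (hind.indepFun_finsetSum_of_notMem hZ (Finset.notMem_erase a _)).symm
  calc ∫⁻ ω, Z a ω * (∑ b, Z b ω) ^ p ∂P
      ≤ ∫⁻ ω, (s * Z a ω ^ (1 + p) + C * (Z a ω * T ω ^ p)) ∂P := by
        refine lintegral_mono fun ω => ?_
        rw [hsplit, ENNReal.rpow_add_of_nonneg _ _ zero_le_one hp, ENNReal.rpow_one]
        calc Z a ω * (Z a ω + T ω) ^ p ≤ Z a ω * (s * Z a ω ^ p + C * T ω ^ p) := by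
              gcongr; exact hsC _ _
          _ = _ := by ring
    _ = s * ∫⁻ ω, Z a ω ^ (1 + p) ∂P + C * ∫⁻ ω, Z a ω * T ω ^ p ∂P := by
        rw [lintegral_add_left (((hZ a).pow_const _).const_mul _),
          lintegral_const_mul _ ((hZ a).pow_const _), lintegral_const_mul _ (by fun_prop)]
    _ = s * ∫⁻ ω, Z a ω ^ (1 + p) ∂P + C * ((∫⁻ ω, Z a ω ∂P) * ∫⁻ ω, T ω ^ p ∂P) := by
        congr 2
        exact lintegral_mul_eq_lintegral_mul_lintegral_of_indepFun (hZ a) (hT_meas.pow_const p)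
          (hZT.comp measurable_id (measurable_id.pow_const p))
    _ ≤ _ := by
        gcongr with ω
        exact hsplit ω ▸ le_add_self

theorem lintegral_sum_rpow_le_add (hZ : ∀ a, Measurable (Z a)) (hind : iIndepFun Z P)
    {p : ℝ} (hp : 0 ≤ p) {s C : ℝ≥0∞}
    (hsC : ∀ x y : ℝ≥0∞, (x + y) ^ p ≤ s * x ^ p + C * y ^ p) :
    ∫⁻ ω, (∑ a, Z a ω) ^ (1 + p) ∂P ≤
      s * ∑ a, ∫⁻ ω, Z a ω ^ (1 + p) ∂P +
        C * ((∑ a, ∫⁻ ω, Z a ω ∂P) * ∫⁻ ω, (∑ a, Z a ω) ^ p ∂P) := by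
  calc ∫⁻ ω, (∑ a, Z a ω) ^ (1 + p) ∂P = ∑ a, ∫⁻ ω, Z a ω * (∑ b, Z b ω) ^ p ∂P := by
        rw [← lintegral_finsetSum _ fun a _ => by fun_prop]
        simp only [ENNReal.rpow_add_of_nonneg _ _ zero_le_one hp, ENNReal.rpow_one, Finset.sum_mul]
    _ ≤ ∑ a, (s * ∫⁻ ω, Z a ω ^ (1 + p) ∂P +
          C * ((∫⁻ ω, Z a ω ∂P) * ∫⁻ ω, (∑ b, Z b ω) ^ p ∂P)) :=
        Finset.sum_le_sum fun a _ => lintegral_mul_sum_rpow_le hZ hind hp hsC a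
    _ = _ := by
        rw [Finset.sum_add_distrib, ← Finset.mul_sum, ← Finset.mul_sum, ← Finset.sum_mul]

theorem mul_lintegral_rpow_le_add [IsProbabilityMeasure P] {f : Ω → ℝ≥0∞} (hf : Measurable f)
    {p : ℝ} (hp : 0 ≤ p) {d : ℝ≥0} (hd : d ≠ 0) (c : ℝ≥0∞) :
    c * ∫⁻ ω, f ω ^ p ∂P ≤ d * ∫⁻ ω, f ω ^ (1 + p) ∂P + (d⁻¹ ^ p : ℝ≥0) * c ^ (1 + p) := by
  calc c * ∫⁻ ω, f ω ^ p ∂P = ∫⁻ ω, c * f ω ^ p ∂P :=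
        (lintegral_const_mul _ (hf.pow_const _)).symm
    _ ≤ ∫⁻ ω, (d * f ω ^ (1 + p) + (d⁻¹ ^ p : ℝ≥0) * c ^ (1 + p)) ∂P :=
        lintegral_mono fun ω => mul_rpow_le_add hp hd c (f ω)
    _ = _ := by
        rw [lintegral_add_right _ measurable_const, lintegral_const, measure_univ, mul_one,
          lintegral_const_mul _ (hf.pow_const _)]

theorem lintegral_sum_rpow_ne_top (hZ : ∀ a, Measurable (Z a)) {q : ℝ} (hq : 1 ≤ q)
    (h : ∑ a, ∫⁻ ω, Z a ω ^ q ∂P ≠ ∞) : ∫⁻ ω, (∑ a, Z a ω) ^ q ∂P ≠ ∞ := by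
  have hcard : (Fintype.card ι : ℝ≥0∞) ^ (q - 1) ≠ ∞ :=
    ENNReal.rpow_ne_top_of_nonneg (sub_nonneg.2 hq) (ENNReal.natCast_ne_top _)
  refine ne_top_of_le_ne_top (ENNReal.mul_ne_top hcard h) ?_
  rw [← lintegral_finsetSum _ fun a _ => (hZ a).pow_const _,
    ← lintegral_const_mul _ (by fun_prop)]
  exact lintegral_mono fun ω => sum_rpow_le_card_rpow_mul _ hq

theorem exists_lintegral_sum_rpow_le {q : ℝ} (hq : 1 ≤ q) {s : ℝ≥0} (hs : 1 < s) :
    ∃ K : ℝ≥0, ∀ {ι Ω : Type*} [Fintype ι] [MeasurableSpace Ω] {P : Measure Ω}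
      {Z : ι → Ω → ℝ≥0∞}, (∀ a, Measurable (Z a)) → iIndepFun Z P →
      ∫⁻ ω, (∑ a, Z a ω) ^ q ∂P ≤
        s * ∑ a, ∫⁻ ω, Z a ω ^ q ∂P + K * (∑ a, ∫⁻ ω, Z a ω ∂P) ^ q := by
  obtain ⟨p, rfl⟩ : ∃ p, q = 1 + p := ⟨q - 1, by ring⟩
  have hp : 0 ≤ p := by linarith
  -- One factor `t = √s` is spent on splitting the sum, the other on absorbing `C * d` times the
  -- left-hand side.
  obtain ⟨t, ht, rfl⟩ : ∃ t : ℝ≥0, 1 < t ∧ t * t = s :=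
    ⟨NNReal.sqrt s, by simpa using NNReal.sqrt_lt_sqrt.2 hs, NNReal.mul_self_sqrt s⟩
  have ht0 : t ≠ 0 := (zero_lt_one.trans ht).ne'
  obtain ⟨C, hC⟩ := exists_add_rpow_le hp ht
  obtain ⟨d, hd0, hCd⟩ : ∃ d : ℝ≥0, d ≠ 0 ∧ C * d ≤ 1 - t⁻¹ := by
    have hη : 0 < 1 - t⁻¹ := tsub_pos_of_lt (inv_lt_one_of_one_lt₀ ht)
    refine ⟨(1 - t⁻¹) / (C + 1), (div_pos hη (by positivity)).ne', ?_⟩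
    rw [mul_div_left_comm]
    exact mul_le_of_le_one_right' (div_le_one_of_le₀ le_self_add (by positivity))
  refine ⟨t * (C * d⁻¹ ^ p), fun {ι Ω} _ _ {P Z} hZ hind => ?_⟩
  have := hind.isProbabilityMeasure
  set A := ∫⁻ ω, (∑ a, Z a ω) ^ (1 + p) ∂P
  set B := ∑ a, ∫⁻ ω, Z a ω ^ (1 + p) ∂P
  set c := ∑ a, ∫⁻ ω, Z a ω ∂P
  by_cases hB : B = ∞
  · simp [hB, ht0]
  have hA : A ≤ t * B + (C * d⁻¹ ^ p : ℝ≥0) * c ^ (1 + p) + (1 - t⁻¹ : ℝ≥0) * A := by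
    calc A ≤ t * B + C * (c * ∫⁻ ω, (∑ a, Z a ω) ^ p ∂P) :=
          lintegral_sum_rpow_le_add hZ hind hp hC
      _ ≤ t * B + C * (d * A + (d⁻¹ ^ p : ℝ≥0) * c ^ (1 + p)) := by
          gcongr
          exact mul_lintegral_rpow_le_add (by fun_prop) hp hd0 c
      _ = t * B + (C * d⁻¹ ^ p : ℝ≥0) * c ^ (1 + p) + (C * d : ℝ≥0) * A := by
          push_cast; ring
      _ ≤ _ := by gcongr
  have habsorb : (t⁻¹ : ℝ≥0) * A ≤ t * B + (C * d⁻¹ ^ p : ℝ≥0) * c ^ (1 + p) :=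
    mul_le_of_le_add_mul
      (by exact_mod_cast add_tsub_cancel_of_le (inv_le_one_of_one_le₀ ht.le))
      (lintegral_sum_rpow_ne_top hZ hq hB) hA
  rw [ENNReal.coe_inv ht0, ENNReal.inv_mul_le_iff (by simpa using ht0) ENNReal.coe_ne_top]
    at habsorb
  refine habsorb.trans_eq ?_
  push_cast
  ring

end Rosenthal

section Independence

variable {Ω : Type*} [MeasurableSpace Ω] {P : Measure Ω}

theorem comap_precomp_eq_iSup {Ω ι κ : Type*} {𝓧 : ι → Type*} [∀ i, MeasurableSpace (𝓧 i)]
    (f : ∀ i, Ω → 𝓧 i) (g : κ → ι) :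
    MeasurableSpace.comap (fun ω k => f (g k) ω) MeasurableSpace.pi =
      ⨆ i ∈ Set.range g, MeasurableSpace.comap (f i) inferInstance := by
  simp only [MeasurableSpace.pi, MeasurableSpace.comap_iSup, MeasurableSpace.comap_comp, iSup_range]
  rfl

theorem indepFun_of_disjoint_range {ι κ₁ κ₂ : Type*} {𝓧 : ι → Type*}
    [∀ i, MeasurableSpace (𝓧 i)] {f : ∀ i, Ω → 𝓧 i} (hf : ∀ i, Measurable (f i))
    (hind : iIndepFun f P) {g₁ : κ₁ → ι} {g₂ : κ₂ → ι}
    (hg : Disjoint (Set.range g₁) (Set.range g₂)) :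
    IndepFun (fun ω k => f (g₁ k) ω) (fun ω k => f (g₂ k) ω) P := by
  rw [IndepFun_iff_Indep, comap_precomp_eq_iSup, comap_precomp_eq_iSup]
  exact indep_iSup_of_disjoint (fun i => (hf i).comap_le) hind hg

theorem iIndepFun_curry {ι : Type*} {κ : ι → Type*} {𝓧 : ∀ i, κ i → Type*}
    [∀ i j, MeasurableSpace (𝓧 i j)] {f : ∀ i j, Ω → 𝓧 i j} (hf : ∀ i j, Measurable (f i j))
    (hind : iIndepFun (fun (x : Σ i, κ i) => f x.1 x.2) P) :
    iIndepFun (fun i ω j => f i j ω) P := by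
  have := hind.isProbabilityMeasure
  have hprob : ∀ i j, IsProbabilityMeasure (P.map (f i j)) := fun i j =>
    Measure.isProbabilityMeasure_map (hf i j).aemeasurable
  have hblock (i) : P.map (fun ω j => f i j ω) = Measure.infinitePi fun j => P.map (f i j) :=
    (hind.precomp (sigma_mk_injective (i := i))).map_fun_eq_infinitePi_map (hf i)
  rw [iIndepFun_iff_map_fun_eq_infinitePi_map (by fun_prop)]
  simp only [hblock]
  rw [← Measure.infinitePi_map_piCurry fun i j => P.map (f i j),
    ← hind.map_fun_eq_infinitePi_map (fun x => hf x.1 x.2),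
    Measure.map_map (by fun_prop) (by fun_prop)]
  rfl

variable {α 𝓧 : Type*} [MeasurableSpace 𝓧] {w : List α → Ω → 𝓧}

theorem iIndepFun_subtree (hind : iIndepFun w P) (a : α) : iIndepFun (fun v => w (a :: v)) P :=
  hind.precomp (List.cons_injective (a := a))

theorem iIndepFun_subtrees (hw : ∀ v, Measurable (w v)) (hind : iIndepFun w P) :
    iIndepFun (fun a ω v => w (a :: v) ω) P := by
  refine iIndepFun_curry (fun a v => hw (a :: v))
    (hind.precomp (g := fun x : Σ _ : α, List α => x.1 :: x.2) ?_)
  rintro ⟨a, u⟩ ⟨b, v⟩ h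
  simpa using h

end Independence

section TreeSum

/-- The total mass of generation `n` of the tree of words over `α`: the sum over the words `v` of
length `n` of `c v` times the product of the weights `w` along the path from the root (whose own
weight `w []` is not counted) to `v`. The recursion is over the subtrees of the children `[a]` of
the root, which are again indexed by all words. -/
noncomputable def treeSum {α : Type*} [Fintype α] : ℕ → (List α → ℝ≥0∞) → (List α → ℝ≥0∞) → ℝ≥0∞
  | 0, _, c => c []
  | n + 1, w, c => ∑ a, w [a] * treeSum n (fun v => w (a :: v)) (fun v => c (a :: v))

variable {α : Type*} [Fintype α]

theorem treeSum_zero (w c : List α → ℝ≥0∞) : treeSum 0 w c = c [] := rfl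

theorem treeSum_succ (n : ℕ) (w c : List α → ℝ≥0∞) :
    treeSum (n + 1) w c = ∑ a, w [a] * treeSum n (fun v => w (a :: v)) (fun v => c (a :: v)) := rfl

theorem sum_vector_succ {M : Type*} [AddCommMonoid M] (n : ℕ) (f : List α → M) :
    ∑ v : List.Vector α (n + 1), f v.toList = ∑ a, ∑ v : List.Vector α n, f (a :: v.toList) := by
  rw [← Fintype.sum_prod_type']
  refine Fintype.sum_equiv
    ⟨fun v => (v.head, v.tail), fun x => x.1 ::ᵥ x.2, fun v => by simp, fun x => by simp⟩ _ _ ?_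
  intro v
  obtain ⟨a, v, rfl⟩ := v.exists_eq_cons
  simp

theorem treeSum_eq_sum (n : ℕ) (w c : List α → ℝ≥0∞) :
    treeSum n w c = ∑ v : List.Vector α n,
      (∏ r ∈ Finset.range n, w (v.toList.take (r + 1))) * c v.toList := by
  induction n generalizing w c with
  | zero => simp [treeSum_zero]
  | succ n ih =>
    rw [sum_vector_succ n fun v => (∏ r ∈ Finset.range (n + 1), w (v.take (r + 1))) * c v]
    simp only [treeSum_succ, ih, Finset.mul_sum, Finset.prod_range_succ', List.take_succ_cons,
      List.take_zero]
    refine Finset.sum_congr rfl fun a _ => Finset.sum_congr rfl fun v _ => ?_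
    ring

theorem treeSum_one {c : List α → ℝ≥0∞} (hc : ∀ u, ∑ a, c (u ++ [a]) = c u) (n : ℕ) :
    treeSum n (fun _ => 1) c = c [] := by
  induction n generalizing c with
  | zero => rfl
  | succ n ih =>
    simp only [treeSum_succ, one_mul]
    rw [← hc []]
    exact Finset.sum_congr rfl fun a _ => ih fun u => hc (a :: u)

theorem treeSum_le_mul_treeSum_succ {w c : List α → ℝ≥0∞} {K : ℝ≥0∞} (hw : ∀ u, 1 ≤ w u)
    (hc : ∀ u, c u ≤ K * ∑ a, c (u ++ [a])) (n : ℕ) :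
    treeSum n w c ≤ K * treeSum (n + 1) w c := by
  induction n generalizing w c with
  | zero =>
    simp only [treeSum_zero, treeSum_succ]
    refine (hc []).trans ?_
    gcongr with a
    exact le_mul_of_one_le_left' (hw [a])
  | succ n ih =>
    rw [treeSum_succ n, treeSum_succ (n + 1), Finset.mul_sum]
    refine Finset.sum_le_sum fun a _ => ?_
    rw [mul_left_comm]
    gcongr
    exact ih (fun u => hw (a :: u)) fun u => hc (a :: u)

theorem recurrence_sum_pow_mul_treeSum (n : ℕ) (s K : ℝ≥0∞) (w c : List α → ℝ≥0∞) :
    s * ∑ a, w [a] *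
        (K * ∑ j ∈ Finset.range n,
            s ^ j * treeSum j (fun v => w (a :: v)) (fun v => c (a :: v)) +
          s ^ n * treeSum n (fun v => w (a :: v)) (fun v => c (a :: v))) + K * c [] =
      K * ∑ j ∈ Finset.range (n + 1), s ^ j * treeSum j w c +
        s ^ (n + 1) * treeSum (n + 1) w c := by
  have hsum : s * ∑ a, w [a] * ∑ j ∈ Finset.range n,
      s ^ j * treeSum j (fun v => w (a :: v)) (fun v => c (a :: v)) =
      ∑ j ∈ Finset.range n, s ^ (j + 1) * treeSum (j + 1) w c := by
    simp only [treeSum_succ, Finset.mul_sum]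
    rw [Finset.sum_comm]
    refine Finset.sum_congr rfl fun j _ => Finset.sum_congr rfl fun a _ => ?_
    ring
  rw [Finset.sum_range_succ', ← hsum]
  simp only [treeSum_succ n, treeSum_zero, mul_add, Finset.sum_add_distrib, pow_zero, one_mul,
    pow_succ', mul_left_comm _ K, mul_left_comm _ (s ^ n), ← Finset.mul_sum, mul_assoc]
  ring

theorem measurable_treeSum (n : ℕ) (c : List α → ℝ≥0∞) : Measurable fun w => treeSum n w c := by
  induction n generalizing c with
  | zero => exact measurable_const
  | succ n ih =>
    refine Finset.measurable_fun_sum _ fun a _ => (measurable_pi_apply [a]).mul ?_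
    exact (ih _).comp (measurable_pi_lambda _ fun v => measurable_pi_apply (a :: v))

end TreeSum

section Moments

variable {α Ω : Type*} [Fintype α] [MeasurableSpace Ω] {P : Measure Ω} {w : List α → Ω → ℝ≥0∞}
  {c : List α → ℝ≥0∞} {q : ℝ}

theorem indepFun_root_treeSum (hw : ∀ v, Measurable (w v)) (hind : iIndepFun w P) (n : ℕ)
    (c : List α → ℝ≥0∞) : IndepFun (w []) (fun ω => treeSum n (w · ω) c) P := by
  have := hind.isProbabilityMeasure
  cases n with
  | zero => exact indepFun_const_right _ _
  | succ n =>
    have hdisj : Disjoint (Set.range fun _ : Unit => ([] : List α))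
        (Set.range fun x : α × List α => x.1 :: x.2) := by
      simp
    have hmeas : Measurable fun x : α × List α → ℝ≥0∞ =>
        ∑ a, x (a, []) * treeSum n (fun v => x (a, v)) (fun v => c (a :: v)) :=
      Finset.measurable_fun_sum _ fun a _ => (measurable_pi_apply _).mul <|
        (measurable_treeSum n _).comp (measurable_pi_lambda _ fun v => measurable_pi_apply (a, v))
    exact (indepFun_of_disjoint_range hw hind hdisj).comp (measurable_pi_apply ()) hmeas

theorem measurable_root_mul_treeSum (hw : ∀ v, Measurable (w v)) (n : ℕ) (c : List α → ℝ≥0∞) :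
    Measurable fun ω => w [] ω * treeSum n (w · ω) c :=
  (hw []).mul ((measurable_treeSum n c).comp (measurable_pi_lambda _ hw))

theorem lintegral_root_mul_treeSum_rpow (hw : ∀ v, Measurable (w v)) (hind : iIndepFun w P)
    (hq : 0 ≤ q) (n : ℕ) (c : List α → ℝ≥0∞) :
    ∫⁻ ω, (w [] ω * treeSum n (w · ω) c) ^ q ∂P =
      (∫⁻ ω, w [] ω ^ q ∂P) * ∫⁻ ω, treeSum n (w · ω) c ^ q ∂P := by
  simp only [ENNReal.mul_rpow_of_nonneg _ _ hq]
  exact lintegral_mul_eq_lintegral_mul_lintegral_of_indepFun ((hw []).pow_const q)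
    (((measurable_treeSum n c).comp (measurable_pi_lambda _ hw)).pow_const q)
    ((indepFun_root_treeSum hw hind n c).comp (measurable_id.pow_const q)
      (measurable_id.pow_const q))

theorem lintegral_treeSum (hw : ∀ v, Measurable (w v)) (hind : iIndepFun w P) (n : ℕ)
    (c : List α → ℝ≥0∞) :
    ∫⁻ ω, treeSum n (w · ω) c ∂P = treeSum n (fun v => ∫⁻ ω, w v ω ∂P) c := by
  have := hind.isProbabilityMeasure
  induction n generalizing w c with
  | zero => simp [treeSum_zero]
  | succ n ih =>
    simp only [treeSum_succ]
    rw [lintegral_finsetSum _ fun a _ =>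
      measurable_root_mul_treeSum (w := fun v => w (a :: v)) (fun v => hw (a :: v)) n _]
    refine Finset.sum_congr rfl fun a _ => ?_
    rw [← ih (fun v => hw (a :: v)) (iIndepFun_subtree hind a)]
    simpa only [ENNReal.rpow_one] using lintegral_root_mul_treeSum_rpow (fun v => hw (a :: v))
      (iIndepFun_subtree hind a) zero_le_one n fun v => c (a :: v)

theorem exists_lintegral_treeSum_succ_rpow_le (hq : 1 ≤ q) {s : ℝ≥0} (hs : 1 < s) :
    ∃ K : ℝ≥0, ∀ {α Ω : Type*} [Fintype α] [MeasurableSpace Ω] {P : Measure Ω}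
      {w : List α → Ω → ℝ≥0∞} {c : List α → ℝ≥0∞}, (∀ v, Measurable (w v)) → iIndepFun w P →
      (∀ v, ∫⁻ ω, w v ω ∂P = 1) → (∀ u, ∑ a, c (u ++ [a]) = c u) → ∀ n,
      ∫⁻ ω, treeSum (n + 1) (w · ω) c ^ q ∂P ≤
        s * ∑ a, (∫⁻ ω, w [a] ω ^ q ∂P) *
            ∫⁻ ω, treeSum n (fun v => w (a :: v) ω) (fun v => c (a :: v)) ^ q ∂P +
          K * c [] ^ q := by
  obtain ⟨K, hK⟩ := exists_lintegral_sum_rpow_le hq hs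
  refine ⟨K, fun {α Ω} _ _ {P w c} hw hind hmean hc n => ?_⟩
  set Z : α → Ω → ℝ≥0∞ := fun a ω =>
    w [a] ω * treeSum n (fun v => w (a :: v) ω) (fun v => c (a :: v))
  have hZ (a) : Measurable (Z a) :=
    measurable_root_mul_treeSum (w := fun v => w (a :: v)) (fun v => hw (a :: v)) n _
  have hZ_indep : iIndepFun Z P := (iIndepFun_subtrees hw hind).comp
    (fun a x => x [] * treeSum n x fun v => c (a :: v))
    fun a => (measurable_pi_apply []).mul (measurable_treeSum n _)
  have hZ_mean : ∑ a, ∫⁻ ω, Z a ω ∂P = c [] := by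
    have h := lintegral_treeSum hw hind (n + 1) c
    simp only [hmean, treeSum_one hc] at h
    rwa [← lintegral_finsetSum _ fun a _ => hZ a]
  have hZ_rpow (a) : ∫⁻ ω, Z a ω ^ q ∂P = (∫⁻ ω, w [a] ω ^ q ∂P) *
      ∫⁻ ω, treeSum n (fun v => w (a :: v) ω) (fun v => c (a :: v)) ^ q ∂P :=
    lintegral_root_mul_treeSum_rpow (fun v => hw (a :: v)) (iIndepFun_subtree hind a)
      (zero_le_one.trans hq) n _
  exact (hK hZ hZ_indep).trans_eq (by simp only [hZ_mean, hZ_rpow])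

theorem exists_lintegral_treeSum_rpow_le (hq : 1 ≤ q) {s : ℝ≥0} (hs : 1 < s) :
    ∃ K : ℝ≥0, ∀ {α Ω : Type*} [Fintype α] [MeasurableSpace Ω] {P : Measure Ω}
      {w : List α → Ω → ℝ≥0∞} {c : List α → ℝ≥0∞}, (∀ v, Measurable (w v)) → iIndepFun w P →
      (∀ v, ∫⁻ ω, w v ω ∂P = 1) → (∀ u, ∑ a, c (u ++ [a]) = c u) → ∀ n,
      ∫⁻ ω, treeSum n (w · ω) c ^ q ∂P ≤
        K * ∑ j ∈ Finset.range n, (s : ℝ≥0∞) ^ j *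
            treeSum j (fun v => ∫⁻ ω, w v ω ^ q ∂P) (fun v => c v ^ q) +
          (s : ℝ≥0∞) ^ n * treeSum n (fun v => ∫⁻ ω, w v ω ^ q ∂P) (fun v => c v ^ q) := by
  obtain ⟨K, hK⟩ := exists_lintegral_treeSum_succ_rpow_le hq hs
  refine ⟨K, fun {α Ω} _ _ {P w c} hw hind hmean hc n => ?_⟩
  have := hind.isProbabilityMeasure
  induction n generalizing w c with
  | zero => simp [treeSum_zero]
  | succ n ih =>
    refine (hK hw hind hmean hc n).trans ?_
    rw [← recurrence_sum_pow_mul_treeSum n s K (fun v => ∫⁻ ω, w v ω ^ q ∂P) fun v => c v ^ q]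
    gcongr with a
    exact ih (fun v => hw (a :: v)) (iIndepFun_subtree hind a) (fun v => hmean (a :: v))
      fun u => hc (a :: u)

theorem one_le_lintegral_rpow [IsProbabilityMeasure P] {f : Ω → ℝ≥0∞} (hf : Measurable f)
    (hmean : ∫⁻ ω, f ω ∂P = 1) (hq : 1 ≤ q) : 1 ≤ ∫⁻ ω, f ω ^ q ∂P := by
  have h := eLpNorm'_le_eLpNorm'_of_exponent_le zero_lt_one hq P hf.aestronglyMeasurable
  simp only [eLpNorm'_eq_lintegral_enorm, enorm_eq_self, ENNReal.rpow_one, hmean, div_one] at h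
  rwa [← ENNReal.one_rpow (1 / q), ENNReal.rpow_le_rpow_iff (by positivity)] at h

end Moments

section RootTest

variable {M : ℕ → ℝ≥0∞}

theorem ne_top_of_limsup_rpow_lt_one {K : ℝ≥0∞} (hK : K ≠ ∞) (hM : ∀ k, M k ≤ K * M (k + 1))
    (h : limsup (fun k : ℕ => M k ^ (1 / (k : ℝ))) atTop < 1) (k : ℕ) : M k ≠ ∞ := by
  obtain ⟨n, hn, hkn⟩ := ((eventually_lt_of_limsup_lt h).and (eventually_gt_atTop k)).exists
  have hMn : M n ≠ ∞ := by
    have hn0 : (0 : ℝ) < n := by exact_mod_cast k.zero_le.trans_lt hkn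
    intro htop
    rw [htop, ENNReal.top_rpow_of_pos (one_div_pos.2 hn0)] at hn
    exact not_top_lt hn
  exact Nat.decreasingInduction (motive := fun j _ => M j ≠ ∞)
    (fun j _ hj => ne_top_of_le_ne_top (ENNReal.mul_ne_top hK hj) (hM j)) hMn hkn.le

theorem exists_tsum_pow_mul_ne_top (hM : ∀ k, M k ≠ ∞)
    (h : limsup (fun k : ℕ => M k ^ (1 / (k : ℝ))) atTop < 1) :
    ∃ s : ℝ≥0, 1 < s ∧ ∑' k, (s : ℝ≥0∞) ^ k * M k ≠ ∞ := by
  obtain ⟨r, hr, hr1⟩ := ENNReal.lt_iff_exists_nnreal_btwn.1 h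
  have hr0 : 0 < r := by exact_mod_cast zero_le.trans_lt hr
  obtain ⟨s, hs, hsr⟩ := exists_between ((one_lt_inv₀ hr0).2 (by exact_mod_cast hr1))
  refine ⟨s, hs, ?_⟩
  lift M to ℕ → ℝ≥0 using hM
  have hMr : ∀ᶠ k in atTop, M k ≤ r ^ k := by
    filter_upwards [eventually_lt_of_limsup_lt hr, eventually_gt_atTop 0] with k hk hk0
    have hk0 : (0 : ℝ) < k := by exact_mod_cast hk0
    have := (ENNReal.rpow_inv_le_iff hk0).1 (one_div (k : ℝ) ▸ hk.le)
    exact_mod_cast this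
  have hsum : Summable fun k => s ^ k * M k := by
    obtain ⟨N, hN⟩ := eventually_atTop.1 hMr
    have hgeom : Summable fun k => (s * r) ^ k :=
      NNReal.summable_geometric ((lt_inv_mul_iff₀' hr0).1 (by simpa using hsr))
    refine (NNReal.summable_nat_add_iff N).1 <| NNReal.summable_of_le (fun k => ?_)
      ((NNReal.summable_nat_add_iff N).2 hgeom)
    rw [mul_pow]
    gcongr
    exact hN _ le_add_self
  exact_mod_cast ENNReal.tsum_coe_ne_top_iff_summable.2 hsum

end RootTest

theorem iSup_lintegral_treeSum_rpow_lt_top {α Ω : Type*} [Fintype α] [MeasurableSpace Ω]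
    {P : Measure Ω} {w : List α → Ω → ℝ≥0∞} {c : List α → ℝ≥0∞} (hw : ∀ v, Measurable (w v))
    (hind : iIndepFun w P) (hmean : ∀ v, ∫⁻ ω, w v ω ∂P = 1) (hc : ∀ u, ∑ a, c (u ++ [a]) = c u)
    {q : ℝ} (hq : 1 ≤ q)
    (h : limsup (fun k : ℕ => treeSum k (fun v => ∫⁻ ω, w v ω ^ q ∂P) (fun v => c v ^ q) ^
      (1 / (k : ℝ))) atTop < 1) :
    ⨆ k, ∫⁻ ω, treeSum k (w · ω) c ^ q ∂P < ∞ := by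
  have := hind.isProbabilityMeasure
  set M : ℕ → ℝ≥0∞ := fun k => treeSum k (fun v => ∫⁻ ω, w v ω ^ q ∂P) (fun v => c v ^ q)
  have hM_succ (k) : M k ≤ (Fintype.card α : ℝ≥0∞) ^ (q - 1) * M (k + 1) :=
    treeSum_le_mul_treeSum_succ (fun u => one_le_lintegral_rpow (hw u) (hmean u) hq)
      (fun u => hc u ▸ sum_rpow_le_card_rpow_mul _ hq) k
  have hM : ∀ k, M k ≠ ∞ := ne_top_of_limsup_rpow_lt_one
    (ENNReal.rpow_ne_top_of_nonneg (sub_nonneg.2 hq) (ENNReal.natCast_ne_top _)) hM_succ h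
  obtain ⟨s, hs, hsum⟩ := exists_tsum_pow_mul_ne_top hM h
  obtain ⟨K, hK⟩ := exists_lintegral_treeSum_rpow_le hq hs
  calc ⨆ k, ∫⁻ ω, treeSum k (w · ω) c ^ q ∂P
      ≤ K * ∑' k, (s : ℝ≥0∞) ^ k * M k + ∑' k, (s : ℝ≥0∞) ^ k * M k := by
        refine iSup_le fun k => (hK hw hind hmean hc k).trans ?_
        gcongr
        · exact ENNReal.sum_le_tsum _
        · exact ENNReal.le_tsum k
    _ < ∞ := (ENNReal.add_ne_top.2 ⟨ENNReal.mul_ne_top ENNReal.coe_ne_top hsum, hsum⟩).lt_top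

section Cylinders

variable {m : ℕ} (μ : Measure (ℕ → Fin m))

theorem cylinder_append_singleton (u : List (Fin m)) (a : Fin m) :
    cylinder (u ++ [a]) = (fun x => x u.length) ⁻¹' {a} ∩ cylinder u := by
  ext x
  simp only [cylinder, Set.mem_ofPred_eq, List.length_append, List.length_singleton,
    Nat.lt_succ_iff_lt_or_eq, Set.mem_inter_iff, Set.mem_preimage, Set.mem_singleton_iff]
  constructor
  · intro h
    refine ⟨by simpa using h u.length (.inr rfl), fun r hr => ?_⟩
    simpa [List.getElem_append_left hr] using h r (.inl hr)
  · rintro ⟨ha, hu⟩ r (hr | rfl)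
    · simpa [List.getElem_append_left hr] using hu r hr
    · simpa using ha

theorem sum_measure_cylinder_append_singleton (u : List (Fin m)) :
    ∑ a, μ (cylinder (u ++ [a])) = μ (cylinder u) := by
  have hmeas (a : Fin m) : MeasurableSet ((fun x : ℕ → Fin m => x u.length) ⁻¹' {a}) :=
    measurable_pi_apply _ (measurableSet_singleton a)
  simp only [cylinder_append_singleton, ← Measure.restrict_apply (hmeas _)]
  rw [sum_measure_preimage_singleton _ fun a _ => hmeas a]
  simp

end Cylinders

section Translation

variable {m : ℕ} {Ω : Type*} {W : List (Fin m) → Ω → ℝ} {μ : Measure (ℕ → Fin m)} {q : ℝ}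

theorem Y_nonneg {ω : Ω} (hω : ∀ i, 0 ≤ W i ω) (i : List (Fin m)) : 0 ≤ Y W μ i ω :=
  mul_nonneg (Finset.prod_nonneg fun _ _ => hω _) measureReal_nonneg

theorem measurable_Y [MeasurableSpace Ω] (hW : ∀ i, Measurable (W i)) (i : List (Fin m)) :
    Measurable (Y W μ i) :=
  (Finset.measurable_fun_prod _ fun _ _ => hW _).mul_const _

variable [IsFiniteMeasure μ]

theorem ofReal_Y {ω : Ω} (hω : ∀ i, 0 ≤ W i ω) (i : List (Fin m)) :
    ENNReal.ofReal (Y W μ i ω) =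
      (∏ r ∈ Finset.range i.length, ENNReal.ofReal (W (i.take (r + 1)) ω)) * μ (cylinder i) := by
  rw [Y, X, ENNReal.ofReal_mul (Finset.prod_nonneg fun _ _ => hω _),
    ENNReal.ofReal_prod_of_nonneg fun _ _ => hω _, ofReal_measureReal]

theorem sum_ofReal_Y_rpow {ω : Ω} (hω : ∀ i, 0 ≤ W i ω) (hq : 0 ≤ q) (k : ℕ) :
    ∑ i : List.Vector (Fin m) k, ENNReal.ofReal (Y W μ i.toList ω) ^ q =
      treeSum k (fun v => ENNReal.ofReal (W v ω) ^ q) (fun v => μ (cylinder v) ^ q) := by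
  simp only [treeSum_eq_sum, ofReal_Y hω, ENNReal.mul_rpow_of_nonneg _ _ hq,
    ENNReal.prod_rpow_of_nonneg hq, List.Vector.toList_length]

theorem ofReal_sum_Y_rpow {ω : Ω} (hω : ∀ i, 0 ≤ W i ω) (hq : 0 ≤ q) (k : ℕ) :
    ENNReal.ofReal ((∑ i : List.Vector (Fin m) k, Y W μ i.toList ω) ^ q) =
      treeSum k (fun v => ENNReal.ofReal (W v ω)) (fun v => μ (cylinder v)) ^ q := by
  have hY (i : List.Vector (Fin m) k) : 0 ≤ Y W μ i.toList ω := Y_nonneg hω _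
  rw [← ENNReal.ofReal_rpow_of_nonneg (Finset.sum_nonneg fun i _ => hY i) hq,
    ENNReal.ofReal_sum_of_nonneg fun i _ => hY i]
  simpa only [ENNReal.rpow_one] using congrArg (· ^ q) (sum_ofReal_Y_rpow hω zero_le_one k)

theorem sum_lintegral_ofReal_Y_rpow [MeasurableSpace Ω] {P : Measure Ω}
    (hW : ∀ i, Measurable (W i)) (hind : iIndepFun W P) (hnonneg : ∀ᵐ ω ∂P, ∀ i, 0 ≤ W i ω)
    (hq : 0 ≤ q) (k : ℕ) :
    ∑ i : List.Vector (Fin m) k, ∫⁻ ω, ENNReal.ofReal (Y W μ i.toList ω ^ q) ∂P =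
      treeSum k (fun v => ∫⁻ ω, ENNReal.ofReal (W v ω) ^ q ∂P) (fun v => μ (cylinder v) ^ q) := by
  have hmeas : Measurable fun x : ℝ => ENNReal.ofReal x ^ q :=
    ENNReal.measurable_ofReal.pow_const q
  rw [← lintegral_finsetSum _ fun i _ => ((measurable_Y hW _).pow_const q).ennreal_ofReal,
    ← lintegral_treeSum (w := fun v ω => ENNReal.ofReal (W v ω) ^ q)
      (fun v => hmeas.comp (hW v)) (hind.comp _ fun _ => hmeas)]
  refine lintegral_congr_ae ?_
  filter_upwards [hnonneg] with ω hω
  simp only [← ENNReal.ofReal_rpow_of_nonneg (Y_nonneg hω _) hq]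
  exact sum_ofReal_Y_rpow hω hq k

end Translation

end Cascade

theorem proposition4p2_general {m : ℕ} {Ω : Type*} [MeasurableSpace Ω]
    (P : Measure Ω)
    (W : List (Fin m) → Ω → ℝ)
    (hW_meas : ∀ i, Measurable (W i))
    (hW_indep : iIndepFun W P)
    (hW_nonneg : ∀ i, ∀ᵐ ω ∂P, 0 ≤ W i ω)
    (hW_mean : ∀ i, ∫ ω, W i ω ∂P = 1)
    (μ : Measure (ℕ → Fin m)) [IsFiniteMeasure μ]
    (q : ℝ) (hq : 1 ≤ q)
    (h : limsup (fun k : ℕ =>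
        (∑ i : List.Vector (Fin m) k,
          ∫⁻ ω, ENNReal.ofReal (Cascade.Y W μ i.toList ω ^ q) ∂P) ^ (1 / (k : ℝ))) atTop < 1) :
    limsup (fun k : ℕ =>
        ∫⁻ ω, ENNReal.ofReal ((∑ i : List.Vector (Fin m) k, Cascade.Y W μ i.toList ω) ^ q) ∂P)
        atTop < ⊤ ∧
      (⨆ k : ℕ,
        ∫⁻ ω, ENNReal.ofReal ((∑ i : List.Vector (Fin m) k, Cascade.Y W μ i.toList ω) ^ q) ∂P)
        < ⊤ := by
  have hnonneg : ∀ᵐ ω ∂P, ∀ i, 0 ≤ W i ω := ae_all_iff.2 hW_nonneg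
  have hq0 : 0 ≤ q := zero_le_one.trans hq
  have hmean (i : List (Fin m)) : ∫⁻ ω, ENNReal.ofReal (W i ω) ∂P = 1 := by
    rw [← ofReal_integral_eq_lintegral_ofReal (.of_integral_ne_zero (by simp [hW_mean]))
      (hW_nonneg i), hW_mean, ENNReal.ofReal_one]
  simp only [Cascade.sum_lintegral_ofReal_Y_rpow hW_meas hW_indep hnonneg hq0] at h
  have hsup := Cascade.iSup_lintegral_treeSum_rpow_lt_top (fun i => (hW_meas i).ennreal_ofReal)
    (hW_indep.comp _ fun _ => ENNReal.measurable_ofReal) hmean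
    (Cascade.sum_measure_cylinder_append_singleton μ) hq h
  simp only [lintegral_congr_ae (hnonneg.mono fun _ hω => Cascade.ofReal_sum_Y_rpow hω hq0 _)]
  exact ⟨limsup_le_iSup.trans_lt hsup, hsup⟩

theorem proposition4p2 {m : ℕ} {Ω : Type*} [MeasurableSpace Ω]
    (P : Measure Ω) [IsProbabilityMeasure P]
    (W : List (Fin m) → Ω → ℝ)
    (hW_meas : ∀ i, Measurable (W i))
    (hW_indep : iIndepFun W P)
    (hW_pos : ∀ i, ∀ᵐ ω ∂P, 0 < W i ω)
    (hW_mean : ∀ i, ∫ ω, W i ω ∂P = 1)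
    (μ : Measure (ℕ → Fin m)) [IsProbabilityMeasure μ]
    (q : ℝ) (hq : 1 ≤ q)
    (h : limsup (fun k : ℕ =>
        (∑ i : List.Vector (Fin m) k,
          ∫⁻ ω, ENNReal.ofReal (Cascade.Y W μ i.toList ω ^ q) ∂P) ^ (1 / (k : ℝ))) atTop < 1) :
    limsup (fun k : ℕ =>
        ∫⁻ ω, ENNReal.ofReal ((∑ i : List.Vector (Fin m) k, Cascade.Y W μ i.toList ω) ^ q) ∂P)
        atTop < ⊤ ∧
      (⨆ k : ℕ,
        ∫⁻ ω, ENNReal.ofReal ((∑ i : List.Vector (Fin m) k, Cascade.Y W μ i.toList ω) ^ q) ∂P)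
        < ⊤ :=
  proposition4p2_general P W hW_meas hW_indep (fun i => (hW_pos i).mono fun _ => le_of_lt) hW_mean
    μ q hq h
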